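/- Let $k$ be an algebraically closed field of characteristic $0$. Let $\mathbb{M}$ be the set of monic polynomials $f\in k((x))[y]$ with $\deg_y f>0$. Every $f\in\mathbb{M}$ of degree $m$ in $y$ has a Puiseux expansion $f=\prod_{i=1}^{m}\bigl(y-p_i(x^{1/n})\bigr)$ with an integer $n\ge 1$ and $p_i(t)\in k((t))$. For $f=\prod_{i=1}^{m_1}\bigl(y-p_i(x^{1/n_1})\bigr)$ and $g=\prod_{j=1}^{m_2}\bigl(y-q_j(x^{1/n_2})\bigr)$ in $\mathbb{M}$ put $$f\star g=\prod_{i,j}\Bigl(y-\bigl(p_i(x^{1/n_1})+q_j(x^{1/n_2})\bigr)\Bigr),\qquad f\bullet g=\prod_{i,j}\Bigl(y-p_i(x^{1/n_1})\,q_j(x^{1/n_2})\Bigr).$$ Let $\mathbb{M}^*\subset\mathbb{M}$ be the set of those $f\in\mathbb{M}$ which have a Puiseux expansion in which every $p_i$ is nonconstant and vanishes at $t=0$ (that is, $p_i\in k((t))\setminus k$ has only terms of positive exponent), and for $f,g\in\mathbb{M}^*$, with such expansions as above, put $$f\odot g=\prod_{i,j}\bigl(y-p_i(r_j)\bigr),\qquad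 r_j=q_j(x^{1/n_2})^{1/n_1},$$ where $r_j$ is, for each $j$, any Puiseux series with $r_j^{n_1}=q_j(x^{1/n_2})$. Then these three operations are well defined (the products are polynomials over $k((x))$ and do not depend on the choice of the expansions and of the roots $r_j$), and: (a) $(\mathbb{M},\star)$ is a commutative semigroup with identity $y$. (b) $(\mathbb{M},\bullet)$ is a commutative semigroup with identity $y-1$. (c) $(\mathbb{M}^*,\odot)$ is a non-commutative semigroup with identity $y-x$. -/

import Mathlib

namespace BivariateComposed

open Polynomial

/-- The substitution `p(t) ↦ p(x^(1/n))`, a ring homomorphism from `k((t))` to the field of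
generalized power series in `x` with rational exponents: the term `a t^i` goes to `a x^(i/n)`.
The ring of Puiseux series is the union of the images over all positive `n`; for `n = 1` this is
the inclusion of `k((x))`. -/
noncomputable def fracSubst (k : Type*) [Field k] (n : ℕ+) :
    LaurentSeries k →+* HahnSeries ℚ k :=
  HahnSeries.embDomainRingHom
    ((AddMonoidHom.mulRight ((n : ℚ)⁻¹)).comp (Int.castAddHom ℚ))
    (fun a b h => by
      have hn : ((n : ℕ) : ℚ)⁻¹ ≠ 0 := by positivity
      simpa [hn] using h)
    (fun a b => by
      have hn : (0 : ℚ) < ((n : ℕ) : ℚ)⁻¹ := by positivity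
      simp [hn])

/-- The inclusion of `k((x))[y]` in the ring of polynomials in `y` whose coefficients are
generalized power series in `x` with rational exponents. -/
noncomputable def toFrac {k : Type*} [Field k] (f : Polynomial (LaurentSeries k)) :
    Polynomial (HahnSeries ℚ k) :=
  f.map (fracSubst k 1)

/-- The set `𝕄` of monic polynomials `f ∈ k((x))[y]` with `deg_y f > 0`. -/
def MSet (k : Type*) [Field k] : Set (Polynomial (LaurentSeries k)) :=
  {f | f.Monic ∧ 0 < f.natDegree}

/-- `f(x,y) = ∏ i, (y - p i (x^(1/n)))` with `p i ∈ k((t))`. -/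
def IsPuiseuxExpansion {k : Type*} [Field k] (f : Polynomial (LaurentSeries k)) {m : ℕ}
    (n : ℕ+) (p : Fin m → LaurentSeries k) : Prop :=
  toFrac f = ∏ i, (X - C (fracSubst k n (p i)))

/-- `p ∈ k((t)) ∖ k`, and `p` vanishes at `t = 0`, that is, `p` has only terms of positive
exponent. -/
def IsNonconstVanishing {k : Type*} [Field k] (p : LaurentSeries k) : Prop :=
  p ∉ Set.range (HahnSeries.C : k →+* LaurentSeries k) ∧ 0 < p.orderTop

/-- The set `𝕄*` of those elements of `𝕄` all of whose Puiseux roots are nonconstant and have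
zero constant term (so that they may be substituted into one another). -/
def MStarSet (k : Type*) [Field k] : Set (Polynomial (LaurentSeries k)) :=
  {f | f ∈ MSet k ∧ ∃ (m : ℕ) (n : ℕ+) (p : Fin m → LaurentSeries k),
    IsPuiseuxExpansion f n p ∧ ∀ i, IsNonconstVanishing (p i)}

/-- The substitution `p(r) = ∑ i, p_i r^i` of a nonzero series `r` of positive order in a Laurent
series `p`: with `p = t^d u(t)`, `d` the order of `p` and `u` a formal power series, it is
`r^d u(r)`. -/
noncomputable def laurentSubst {k : Type*} [Field k] (p : LaurentSeries k) (r : HahnSeries ℚ k) :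
    HahnSeries ℚ k :=
  r ^ p.order * PowerSeries.heval r p.powerSeriesPart

/-- `h = f ⋆ g`, the composed sum: for some Puiseux expansions of `f` and `g`,
`h = ∏ i, ∏ j, (y - (p i (x^(1/n₁)) + q j (x^(1/n₂))))`. -/
def IsComposedSum {k : Type*} [Field k] (f g h : Polynomial (LaurentSeries k)) : Prop :=
  ∃ (m₁ m₂ : ℕ) (n₁ n₂ : ℕ+) (p : Fin m₁ → LaurentSeries k) (q : Fin m₂ → LaurentSeries k),
    IsPuiseuxExpansion f n₁ p ∧ IsPuiseuxExpansion g n₂ q ∧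
    toFrac h = ∏ i, ∏ j, (X - C (fracSubst k n₁ (p i) + fracSubst k n₂ (q j)))

/-- `h = f • g`, the composed multiplication: for some Puiseux expansions of `f` and `g`,
`h = ∏ i, ∏ j, (y - p i (x^(1/n₁)) * q j (x^(1/n₂)))`. -/
def IsComposedMul {k : Type*} [Field k] (f g h : Polynomial (LaurentSeries k)) : Prop :=
  ∃ (m₁ m₂ : ℕ) (n₁ n₂ : ℕ+) (p : Fin m₁ → LaurentSeries k) (q : Fin m₂ → LaurentSeries k),
    IsPuiseuxExpansion f n₁ p ∧ IsPuiseuxExpansion g n₂ q ∧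
    toFrac h = ∏ i, ∏ j, (X - C (fracSubst k n₁ (p i) * fracSubst k n₂ (q j)))

/-- `h = f ⊙ g`, the composed product: for some Puiseux expansions of `f` and `g` whose roots are
nonconstant with zero constant term, and some choice, for every `j`, of an `n₁`-th root
`r j = q j (x^(1/n₂))^(1/n₁)`, one has `h = ∏ i, ∏ j, (y - p i (r j))`. -/
def IsComposedProd {k : Type*} [Field k] (f g h : Polynomial (LaurentSeries k)) : Prop :=
  ∃ (m₁ m₂ : ℕ) (n₁ n₂ : ℕ+) (p : Fin m₁ → LaurentSeries k) (q : Fin m₂ → LaurentSeries k)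
    (r : Fin m₂ → HahnSeries ℚ k),
    IsPuiseuxExpansion f n₁ p ∧ IsPuiseuxExpansion g n₂ q ∧
    (∀ i, IsNonconstVanishing (p i)) ∧ (∀ j, IsNonconstVanishing (q j)) ∧
    (∀ j, r j ^ (n₁ : ℕ) = fracSubst k n₂ (q j)) ∧
    toFrac h = ∏ i, ∏ j, (X - C (laurentSubst (p i) (r j)))

end BivariateComposed

/-!
The three operations compose Puiseux roots, and the proof works throughout in the field of
generalized power series with rational exponents, in which all Puiseux series live.

*Puiseux's theorem* (`splitsAfterRamification`). A monic polynomial over `k((t))` splits after some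
substitution `t ↦ t ^ N`, by induction on the degree `m`. A translation removes the term of degree
`m - 1`; a ramification and a rescaling of the roots by the first slope of the Newton polygon give a
polynomial over `k[[t]]` whose reduction is not a power of a linear polynomial. After translating a
root of the reduction to `0`, the distinguished polynomial of the Weierstrass preparation theorem is
a proper factor (`exists_proper_factor_of_reduction`).

*Descent* (`exists_monic_toFrac_eq`). A character `χ` of `ℚ / ℤ` with values in `kˣ` acts on
generalized power series by `x ^ a ↦ χ(a) x ^ a`. As `kˣ` is divisible and contains all roots of
unity, such characters separate the points of `ℚ / ℤ`, so the common fixed field is `k((x))`. The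
multiset of Puiseux roots of a polynomial over `k((x))` is invariant, hence so are the products that
define the three operations.

*Composed sum and multiplication* (`exists_composedBy_commMonoid`). An element of `𝕄` is determined
by its multiset of roots, so both monoid laws are inherited from addition and multiplication of
series.

*Composed product* (`exists_composedProd_monoid`). A ring homomorphism from `k((x))` that fixes the
constants and preserves integrality is determined by the image of `x`, if that has positive order
(`IsIntegralHom.ext`). This gives `f(r ^ n, y) = ∏ i, (y - p i (r))` when `f` has the roots
`p i (x^(1/n))`, and so `f ⊙ g = ∏ f(s, y)` over the roots `s` of `g`, an expression in which
neither the expansion of `f` nor the roots `r j` occur. The same principle shows that substitution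
is associative, and this yields the associativity of the composed product
(`map_substHom_of_toFrac_eq_prodSubst`).
-/

namespace BivariateComposed

open Polynomial

/-! ### Ramification -/

section Ramify

variable {k : Type*} [Field k]

/-- The substitution `p(t) ↦ p(t^N)`, a ring endomorphism of `k((t))`. -/
noncomputable def ramify (k : Type*) [Field k] (N : ℕ+) : LaurentSeries k →+* LaurentSeries k :=
  HahnSeries.embDomainRingHom (AddMonoidHom.mulRight (N : ℤ))
    (fun a b h => by
      have hN : ((N : ℕ) : ℤ) ≠ 0 := by exact_mod_cast N.ne_zero
      simpa [hN] using h)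
    (fun a b => by simp)

theorem orderTop_ramify (N : ℕ+) (p : LaurentSeries k) :
    (ramify k N p).orderTop = p.orderTop.map (fun a => a * (N : ℤ)) :=
  HahnSeries.orderTop_embDomain

theorem orderTop_fracSubst (n : ℕ+) (p : LaurentSeries k) :
    (fracSubst k n p).orderTop = p.orderTop.map (fun a : ℤ => (a : ℚ) * (n : ℚ)⁻¹) :=
  HahnSeries.orderTop_embDomain

theorem ramify_single (N : ℕ+) (a : ℤ) (c : k) :
    ramify k N (HahnSeries.single a c) = HahnSeries.single (a * N) c :=
  HahnSeries.embDomain_single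

theorem fracSubst_single (n : ℕ+) (a : ℤ) (c : k) :
    fracSubst k n (HahnSeries.single a c) = HahnSeries.single ((a : ℚ) * (n : ℚ)⁻¹) c :=
  HahnSeries.embDomain_single

theorem coeff_ramify_mul (N : ℕ+) (p : LaurentSeries k) (a : ℤ) :
    (ramify k N p).coeff (a * N) = p.coeff a :=
  HahnSeries.embDomain_mk_coeff (f := fun a : ℤ => a * N) _ _

theorem embDomainRingHom_comp {A B D : Type*} [AddCommGroup A] [LinearOrder A]
    [IsOrderedAddMonoid A] [AddCommGroup B] [LinearOrder B] [IsOrderedAddMonoid B]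
    [AddCommGroup D] [LinearOrder D] [IsOrderedAddMonoid D]
    (f : A →+ B) (hf hf') (g : B →+ D) (hg hg') (e : A →+ D) (he he') (h : ∀ a, g (f a) = e a)
    (x : HahnSeries A k) :
    HahnSeries.embDomainRingHom g hg hg' (HahnSeries.embDomainRingHom f hf hf' x) =
      HahnSeries.embDomainRingHom e he he' x := by
  change HahnSeries.embDomain _ (HahnSeries.embDomain _ x) = HahnSeries.embDomain _ x
  ext d
  by_cases hd : ∃ a, e a = d
  · obtain ⟨a, rfl⟩ := hd
    rw [HahnSeries.embDomain_mk_coeff (f := e), ← h a, HahnSeries.embDomain_mk_coeff (f := g),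
      HahnSeries.embDomain_mk_coeff (f := f)]
  · rw [HahnSeries.embDomain_of_notMem_range (f := (⟨⟨e, he⟩, he' _ _⟩ : A ↪o D))
      (fun ⟨a, ha⟩ => hd ⟨a, ha⟩)]
    by_contra hne
    obtain ⟨b, hb, rfl⟩ := HahnSeries.support_embDomain_subset (HahnSeries.mem_support _ _ |>.2 hne)
    obtain ⟨a, -, rfl⟩ := HahnSeries.support_embDomain_subset hb
    exact hd ⟨a, (h a).symm⟩

theorem exists_ofPowerSeries_eq {p : LaurentSeries k} (hp : 0 ≤ p.orderTop) :
    ∃ a : PowerSeries k, HahnSeries.ofPowerSeries ℤ k a = p := by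
  refine ⟨PowerSeries.mk fun n => p.coeff n, ?_⟩
  ext i
  rw [PowerSeries.coeff_coe, PowerSeries.coeff_mk]
  split_ifs with hi
  · exact (HahnSeries.coeff_eq_zero_of_lt_orderTop
      (lt_of_lt_of_le (by exact_mod_cast hi) hp)).symm
  · rw [Int.natAbs_of_nonneg (not_lt.1 hi)]

theorem orderTop_ofPowerSeries_nonneg (a : PowerSeries k) :
    0 ≤ (HahnSeries.ofPowerSeries ℤ k a).orderTop := by
  refine HahnSeries.le_orderTop_iff_forall.2 fun i hi => ?_
  rw [PowerSeries.coeff_coe, if_pos (by exact_mod_cast hi)]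

theorem ramify_comp_ramify (M N : ℕ+) :
    (ramify k M).comp (ramify k N) = ramify k (N * M) :=
  RingHom.ext fun x => embDomainRingHom_comp _ _ _ _ _ _ _ _ _
    (fun a => by simp [mul_assoc]) x

theorem fracSubst_comp_ramify (n N : ℕ+) :
    (fracSubst k (n * N)).comp (ramify k N) = fracSubst k n :=
  RingHom.ext fun x => embDomainRingHom_comp _ _ _ _ _ _ _ _ _
    (fun a => by
      have hN : ((N : ℕ) : ℚ) ≠ 0 := by exact_mod_cast N.ne_zero
      have hn : ((n : ℕ) : ℚ) ≠ 0 := by exact_mod_cast n.ne_zero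
      simp
      field_simp) x

theorem fracSubst_comp_ramify_self (n : ℕ+) :
    (fracSubst k n).comp (ramify k n) = fracSubst k 1 := by
  simpa using fracSubst_comp_ramify (k := k) 1 n

end Ramify

/-! ### Puiseux's theorem -/

section Puiseux

variable {k : Type*} [Field k]

/-- A case of Hensel's lemma: a monic polynomial over `k[[t]]` whose reduction vanishes at `0`
but is not a power of the variable has a proper monic factor, namely the distinguished polynomial
of the Weierstrass preparation theorem. -/
theorem exists_proper_factor_of_reduction (G : (PowerSeries k)[X]) (hG : G.Monic)
    (h0 : PowerSeries.constantCoeff (G.coeff 0) = 0)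
    (hne : G.map PowerSeries.constantCoeff ≠ X ^ G.natDegree) :
    ∃ P Q : (PowerSeries k)[X], P.Monic ∧ Q.Monic ∧ G = P * Q ∧
      P.natDegree < G.natDegree ∧ Q.natDegree < G.natDegree := by
  have : IsAdicComplete (IsLocalRing.maximalIdeal (PowerSeries k)) (PowerSeries k) := by
    rw [PowerSeries.maximalIdeal_eq_span_X]
    infer_instance
  have hmap : (G : PowerSeries (PowerSeries k)).map (IsLocalRing.residue (PowerSeries k)) ≠ 0 := by
    rw [← Polynomial.polynomial_map_coe]
    exact_mod_cast (hG.map _).ne_zero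
  obtain ⟨P, h, hP, hu, hPh⟩ := PowerSeries.exists_isWeierstrassFactorization hmap
  have hbarP : P.map PowerSeries.constantCoeff = X ^ P.natDegree := by
    ext i
    rw [coeff_map, coeff_X_pow]
    rcases lt_trichotomy i P.natDegree with hi | rfl | hi
    · have := hP.mem hi
      rw [PowerSeries.maximalIdeal_eq_span_X, Ideal.mem_span_singleton,
        PowerSeries.X_dvd_iff] at this
      simp [this, hi.ne]
    · simp [hP.monic]
    · simp [coeff_eq_zero_of_natDegree_lt hi, hi.ne']
  have hdeg : ((G %ₘ P).degree < P.natDegree) := by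
    rw [← degree_eq_natDegree hP.monic.ne_zero]
    exact degree_modByMonic_lt _ hP.monic
  have hord : ((P : PowerSeries (PowerSeries k)).map
      (Ideal.Quotient.mk (IsLocalRing.maximalIdeal (PowerSeries k)))).order.toNat =
      P.natDegree := by
    have h1 := hP.coe_natDegree_eq_order_map (P : PowerSeries (PowerSeries k)) 1
      (by simp) (by simp)
    rw [← h1]
    rfl
  -- Weierstrass division by `P` is unique, so the remainder of the Euclidean division is zero.
  have hr := (hP.isWeierstrassDivisorAt'.eq_of_mul_add_eq_mul_add
    (q := h) (q' := (G /ₘ P : (PowerSeries k)[X])) (r := 0) (r' := G %ₘ P)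
    (by simp [hord]) (by rw [hord]; exact hdeg) (by
      rw [← hPh]
      conv_lhs => rw [← modByMonic_add_div G P]
      push_cast
      simp [add_comm])).2
  have hfac : G = P * (G /ₘ P) := by
    conv_lhs => rw [← modByMonic_add_div G P, ← hr, zero_add]
  have hQ : (G /ₘ P).Monic := hP.monic.of_mul_monic_left (hfac ▸ hG)
  have hsum : G.natDegree = P.natDegree + (G /ₘ P).natDegree := by
    conv_lhs => rw [hfac, hP.monic.natDegree_mul hQ]
  refine ⟨P, G /ₘ P, hP.monic, hQ, hfac, ?_, ?_⟩
  -- If `P` has the degree of `G`, then `G = P` reduces to a power of the variable.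
  · refine lt_of_le_of_ne (by omega) fun heq => hne ?_
    have : G /ₘ P = 1 := hQ.natDegree_eq_zero.1 (by omega)
    rw [this, mul_one] at hfac
    rw [hfac, hbarP]
  -- If `P` has degree zero, then `G` is a unit as a power series.
  · refine lt_of_le_of_ne (by omega) fun heq => ?_
    have : P = 1 := hP.monic.natDegree_eq_zero.1 (by omega)
    have hunit : IsUnit (PowerSeries.constantCoeff (PowerSeries.constantCoeff
        (G : PowerSeries (PowerSeries k)))) := by
      rw [hPh, this]
      simpa using (hu.map PowerSeries.constantCoeff).map PowerSeries.constantCoeff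
    rw [← PowerSeries.coeff_zero_eq_constantCoeff_apply (φ := (G : PowerSeries (PowerSeries k))),
      Polynomial.coeff_coe, h0] at hunit
    exact not_isUnit_zero hunit

/-- `f ∈ k((t))[y]` splits over `k((t^(1/N)))` for some `N`. -/
def SplitsAfterRamification (f : (LaurentSeries k)[X]) : Prop :=
  ∃ N : ℕ+, (f.map (ramify k N)).Splits

namespace SplitsAfterRamification

theorem of_splits {f : (LaurentSeries k)[X]} (hf : f.Splits) : SplitsAfterRamification f :=
  ⟨1, hf.map _⟩

theorem mul {f g : (LaurentSeries k)[X]} (hf : SplitsAfterRamification f)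
    (hg : SplitsAfterRamification g) : SplitsAfterRamification (f * g) := by
  obtain ⟨M, hM⟩ := hf
  obtain ⟨N, hN⟩ := hg
  refine ⟨M * N, ?_⟩
  rw [Polynomial.map_mul]
  refine Splits.mul ?_ ?_
  · simpa [Polynomial.map_map, ramify_comp_ramify] using hM.map (ramify k N)
  · simpa [Polynomial.map_map, ramify_comp_ramify, mul_comm] using hN.map (ramify k M)

theorem of_map_ramify {f : (LaurentSeries k)[X]} {N : ℕ+}
    (hf : SplitsAfterRamification (f.map (ramify k N))) : SplitsAfterRamification f := by
  obtain ⟨M, hM⟩ := hf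
  exact ⟨N * M, by simpa [Polynomial.map_map, ramify_comp_ramify] using hM⟩

theorem of_taylor {f : (LaurentSeries k)[X]} {r : LaurentSeries k}
    (hf : SplitsAfterRamification (taylor r f)) : SplitsAfterRamification f := by
  obtain ⟨M, hM⟩ := hf
  refine ⟨M, ?_⟩
  have := hM.taylor (-ramify k M r)
  rwa [map_taylor, taylor_taylor, neg_add_cancel, taylor_zero] at this

theorem of_scaleRoots {f : (LaurentSeries k)[X]} {s : LaurentSeries k} (hs : s ≠ 0)
    (hf : SplitsAfterRamification (f.scaleRoots s)) : SplitsAfterRamification f := by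
  obtain ⟨M, hM⟩ := hf
  refine ⟨M, ?_⟩
  have h := hM.scaleRoots (ramify k M s⁻¹)
  by_cases hf0 : f = 0
  · simp [hf0]
  rw [map_scaleRoots _ _ _ (by simpa using hf0), ← scaleRoots_mul, ← map_mul,
    mul_inv_cancel₀ hs, map_one, scaleRoots_one] at h
  exact h

end SplitsAfterRamification

/-- The inductive step of Puiseux's theorem for a polynomial that is integral over `k[[t]]` and
whose reduction is not a power of a linear polynomial. -/
theorem splitsAfterRamification_of_integral [IsAlgClosed k] (F : (PowerSeries k)[X])
    (hF : F.Monic) (hdeg : 0 < F.natDegree)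
    (hne : ∀ c : k, F.map PowerSeries.constantCoeff ≠ (X - C c) ^ F.natDegree)
    (ih : ∀ f : (LaurentSeries k)[X], f.Monic → f.natDegree < F.natDegree →
      SplitsAfterRamification f) :
    SplitsAfterRamification (F.map (HahnSeries.ofPowerSeries ℤ k)) := by
  have hFm : (F.map (PowerSeries.constantCoeff (R := k))).Monic := hF.map _
  obtain ⟨c, hc⟩ := IsAlgClosed.exists_root (F.map (PowerSeries.constantCoeff (R := k))) (by
    rw [degree_eq_natDegree hFm.ne_zero, hF.natDegree_map]
    exact_mod_cast hdeg.ne')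
  obtain ⟨P, Q, hP, hQ, hPQ, hPd, hQd⟩ := exists_proper_factor_of_reduction
    (taylor (PowerSeries.C c) F) ((leadingCoeff_taylor _ _).trans hF)
    (by
      rw [taylor_coeff_zero, ← eval₂_hom, ← eval_map]
      simpa using hc)
    (by
      rw [Polynomial.map_taylor, natDegree_taylor, PowerSeries.constantCoeff_C]
      intro h
      apply hne c
      have := congrArg (taylor (-c)) h
      simpa [taylor_taylor, sub_eq_add_neg] using this)
  rw [natDegree_taylor] at hPd hQd
  refine SplitsAfterRamification.of_taylor
    (r := HahnSeries.ofPowerSeries ℤ k (PowerSeries.C c)) ?_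
  rw [← Polynomial.map_taylor, hPQ, Polynomial.map_mul]
  exact (ih _ (hP.map _) (by rwa [hP.natDegree_map])).mul
    (ih _ (hQ.map _) (by rwa [hQ.natDegree_map]))

/-- The inductive step of Puiseux's theorem for a polynomial without term of degree `m - 1`: the
first slope of its Newton polygon makes it integral with a suitable reduction. -/
theorem splitsAfterRamification_of_coeff_eq_zero [IsAlgClosed k] [CharZero k]
    (f : (LaurentSeries k)[X]) {m : ℕ} (hf : f.Monic) (hm : f.natDegree = m + 1)
    (hcoeff : f.coeff m = 0)
    (ih : ∀ g : (LaurentSeries k)[X], g.Monic → g.natDegree < f.natDegree →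
      SplitsAfterRamification g) :
    SplitsAfterRamification f := by
  classical
  by_cases hX : f = X ^ (m + 1)
  · exact .of_splits (hX ▸ .X_pow _)
  let s : Finset ℕ := (Finset.range (m + 1)).filter fun i => f.coeff i ≠ 0
  have hs : s.Nonempty := by
    by_contra hs
    rw [Finset.not_nonempty_iff_eq_empty, Finset.filter_eq_empty_iff] at hs
    refine hX (Polynomial.ext fun i => ?_)
    rw [coeff_X_pow]
    rcases lt_trichotomy i (m + 1) with hi | rfl | hi
    · simpa [hi.ne] using hs (Finset.mem_range.2 hi)
    · simpa [hm] using hf.coeff_natDegree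
    · simpa [hi.ne'] using coeff_eq_zero_of_natDegree_lt (hm ▸ hi)
  obtain ⟨j, hj, hmin⟩ := s.exists_min_image
    (fun i => ((f.coeff i).order : ℚ) / ((m + 1 - i : ℕ) : ℚ)) hs
  obtain ⟨hjm, hj0⟩ := Finset.mem_filter.1 hj
  rw [Finset.mem_range] at hjm
  -- The slope is `u / v`; after `t ↦ t ^ v` the roots are divided by `t ^ u`.
  set u : ℤ := (f.coeff j).order with hu
  let v : ℕ+ := ⟨m + 1 - j, by omega⟩
  have hv : ((v : ℕ) : ℤ) = (m + 1 - j : ℕ) := rfl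
  let T : LaurentSeries k := HahnSeries.single (-u) 1
  have hT : T ≠ 0 := by simp [T]
  refine SplitsAfterRamification.of_map_ramify (N := v)
    (SplitsAfterRamification.of_scaleRoots hT ?_)
  set g := (f.map (ramify k v)).scaleRoots T with hg
  have hfv : (f.map (ramify k v)).natDegree = m + 1 := by rw [hf.natDegree_map, hm]
  have hgm : g.Monic := (monic_scaleRoots_iff _).2 (hf.map _)
  have hgd : g.natDegree = m + 1 := by rw [hg, natDegree_scaleRoots, hfv]
  have hgc (i : ℕ) : g.coeff i =
      ramify k v (f.coeff i) * HahnSeries.single (-((m + 1 - i : ℕ) * u)) 1 := by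
    rw [hg, coeff_scaleRoots, hfv, coeff_map, HahnSeries.single_pow]
    simp
  have hgord (i : ℕ) : 0 ≤ (g.coeff i).orderTop := by
    rcases eq_or_ne (f.coeff i) 0 with h0 | h0
    · simp [hgc, h0]
    rcases lt_or_ge i (m + 1) with hi | hi
    · have h1 := hmin i (Finset.mem_filter.2 ⟨Finset.mem_range.2 hi, h0⟩)
      rw [div_le_div_iff₀ (by exact_mod_cast (by omega)) (by exact_mod_cast (by omega))] at h1
      have h2 : u * (m + 1 - i : ℕ) ≤ (f.coeff i).order * (m + 1 - j : ℕ) := by exact_mod_cast h1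
      rw [hgc, HahnSeries.orderTop_mul, orderTop_ramify, HahnSeries.orderTop_single one_ne_zero,
        ← HahnSeries.order_eq_orderTop_of_ne_zero h0, WithTop.map_coe, hv]
      norm_cast
      linarith
    · rcases hi.eq_or_lt with rfl | hi
      · rw [← hgd, hgm.coeff_natDegree]
        simp
      · exact absurd (coeff_eq_zero_of_natDegree_lt (hm ▸ hi)) h0
  obtain ⟨F, hFg, hFd, hFm⟩ := lifts_and_natDegree_eq_and_monic
    ((lifts_iff_coeff_lifts (f := HahnSeries.ofPowerSeries ℤ k) g).2 fun i =>
      exists_ofPowerSeries_eq (hgord i)) hgm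
  have hFc (i : ℕ) : PowerSeries.constantCoeff (F.coeff i) = (g.coeff i).coeff 0 := by
    rw [← hFg, coeff_map, ← PowerSeries.coeff_zero_eq_constantCoeff_apply]
    exact (LaurentSeries.coeff_coe_powerSeries _ 0).symm
  rw [hgd] at hFd
  rw [← hFg]
  refine splitsAfterRamification_of_integral F hFm (by omega) (fun c hc => ?_)
    (fun h hh hd => ih h hh (by omega))
  have hcm := congrArg (fun p => p.coeff m) hc
  have hcj := congrArg (fun p => p.coeff j) hc
  simp only [coeff_map, hFc, hgc, hcoeff, hFd] at hcm hcj
  -- The term of degree `m` vanishes, so in characteristic zero the reduction can only be a power of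
  -- the variable; but its coefficient of degree `j` is the leading coefficient of `f.coeff j`.
  have hc0 : c = 0 := by
    rw [sub_eq_add_neg, ← C_neg, coeff_X_add_C_pow] at hcm
    have : (m : k) + 1 ≠ 0 := by exact_mod_cast m.succ_ne_zero
    simpa [Nat.choose_succ_self_right, this] using hcm
  rw [hc0, C_0, sub_zero, coeff_X_pow, if_neg hjm.ne, HahnSeries.coeff_mul_single, mul_one,
    zero_sub, neg_neg, mul_comm, ← hv, coeff_ramify_mul, hu] at hcj
  exact hj0 (HahnSeries.coeff_order_eq_zero.1 hcj)

/-- **Puiseux's theorem**: over an algebraically closed field `k` of characteristic zero, a monic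
polynomial with coefficients in `k((t))` splits over some `k((t^(1/N)))`. -/
theorem splitsAfterRamification [IsAlgClosed k] [CharZero k] (f : (LaurentSeries k)[X])
    (hf : f.Monic) : SplitsAfterRamification f := by
  induction hn : f.natDegree using Nat.strong_induction_on generalizing f with
  | _ n ih =>
    obtain _ | m := n
    · exact .of_splits (.of_natDegree_eq_zero hn)
    -- The translation that removes the term of degree `m`.
    let c : LaurentSeries k := -f.coeff m / ((m + 1 : ℕ) : LaurentSeries k)
    have : CharZero (LaurentSeries k) :=
      charZero_of_injective_ringHom (HahnSeries.C_injective (Γ := ℤ) (R := k))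
    refine SplitsAfterRamification.of_taylor (r := c)
      (splitsAfterRamification_of_coeff_eq_zero _ ((leadingCoeff_taylor _ _).trans hf)
        (m := m) (by rw [natDegree_taylor, hn]) ?_ fun g hg hd => ?_)
    · have hne : ((m + 1 : ℕ) : LaurentSeries k) ≠ 0 := by exact_mod_cast m.succ_ne_zero
      have hdeg : (hasseDeriv m f).natDegree < 2 :=
        lt_of_le_of_lt (natDegree_hasseDeriv_le f m) (by omega)
      have hlead : f.coeff (m + 1) = 1 := hn ▸ hf.coeff_natDegree
      rw [taylor_coeff, eval_eq_sum_range' hdeg]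
      simp only [Finset.sum_range_succ, Finset.range_zero, Finset.sum_empty, hasseDeriv_coeff,
        pow_zero, pow_one, add_comm 1 m, hlead, zero_add, mul_one, Nat.choose_self,
        Nat.choose_succ_self_right, Nat.cast_one, one_mul, c]
      field_simp
      ring
    · rw [natDegree_taylor] at hd
      exact ih _ (hn ▸ hd) g hg rfl

end Puiseux

/-! ### Substitution of series of positive order -/

section Subst

variable {k : Type*} [Field k] {Γ : Type*} [AddCommGroup Γ] [LinearOrder Γ]
  [IsOrderedAddMonoid Γ]

/-- `r` is nonzero of positive order, so that it may be substituted in a Laurent series. -/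
def IsPosOrder (r : HahnSeries Γ k) : Prop :=
  r ≠ 0 ∧ 0 < r.orderTop

omit [IsOrderedAddMonoid Γ] in
theorem isPosOrder_single {a : Γ} (ha : 0 < a) {c : k} (hc : c ≠ 0) :
    IsPosOrder (HahnSeries.single a c) :=
  ⟨by simpa using hc, by rw [HahnSeries.orderTop_single hc]; exact_mod_cast ha⟩

theorem orderTop_pow (r : HahnSeries Γ k) (n : ℕ) : (r ^ n).orderTop = n • r.orderTop :=
  (HahnSeries.addVal Γ k).map_pow r n

theorem IsPosOrder.pow {r : HahnSeries Γ k} (hr : IsPosOrder r) (n : ℕ+) :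
    IsPosOrder (r ^ (n : ℕ)) :=
  ⟨pow_ne_zero _ hr.1, lt_of_lt_of_le ((nsmul_pos_iff n.ne_zero).2 hr.2)
    HahnSeries.orderTop_nsmul_le_orderTop_pow⟩

theorem IsPosOrder.of_pow {r : HahnSeries Γ k} {n : ℕ} (hn : n ≠ 0) (h : IsPosOrder (r ^ n)) :
    IsPosOrder r := by
  have hr : r ≠ 0 := fun h0 => h.1 (by rw [h0, zero_pow hn])
  refine ⟨hr, ?_⟩
  have := h.2
  rw [orderTop_pow] at this
  exact (nsmul_pos_iff hn).1 this

theorem IsNonconstVanishing.isPosOrder {p : LaurentSeries k} (hp : IsNonconstVanishing p) :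
    IsPosOrder p :=
  ⟨fun h => hp.1 ⟨0, by simp [h]⟩, hp.2⟩

theorem IsPosOrder.isNonconstVanishing {p : LaurentSeries k} (hp : IsPosOrder p) :
    IsNonconstVanishing p := by
  refine ⟨?_, hp.2⟩
  rintro ⟨c, rfl⟩
  have hc : c ≠ 0 := fun h => hp.1 (by simp [h])
  have := hp.2
  rw [HahnSeries.C_apply, HahnSeries.orderTop_single hc] at this
  exact lt_irrefl _ this

/-- Evaluation of power series at a series of positive order takes values of nonnegative order. -/
theorem orderTop_heval_nonneg {r : HahnSeries Γ k} (hr : 0 < r.orderTop) (a : PowerSeries k) :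
    0 ≤ (PowerSeries.heval r a).orderTop := by
  refine HahnSeries.le_orderTop_iff_forall.2 fun g hg => ?_
  rw [PowerSeries.coeff_heval]
  refine finsum_eq_zero_of_forall_eq_zero fun n => ?_
  rw [HahnSeries.SummableFamily.coeff_apply,
    HahnSeries.SummableFamily.powerSeriesFamily_of_orderTop_pos hr, HahnSeries.coeff_smul,
    HahnSeries.coeff_eq_zero_of_lt_orderTop, smul_zero]
  exact lt_of_lt_of_le hg (le_trans (nsmul_nonneg hr.le n)
    HahnSeries.orderTop_nsmul_le_orderTop_pow)

/-- A ring homomorphism between rings of generalized power series that fixes the constants and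
sends series of nonnegative order to series of nonnegative order. -/
structure IsIntegralHom {Γ' : Type*} [AddCommGroup Γ'] [LinearOrder Γ'] [IsOrderedAddMonoid Γ']
    (φ : HahnSeries Γ k →+* HahnSeries Γ' k) : Prop where
  map_C (c : k) : φ (HahnSeries.C c) = HahnSeries.C c
  orderTop_nonneg (p : HahnSeries Γ k) : 0 ≤ p.orderTop → 0 ≤ (φ p).orderTop

theorem IsIntegralHom.comp {Γ₁ Γ₂ Γ₃ : Type*} [AddCommGroup Γ₁] [LinearOrder Γ₁]
    [IsOrderedAddMonoid Γ₁] [AddCommGroup Γ₂] [LinearOrder Γ₂] [IsOrderedAddMonoid Γ₂]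
    [AddCommGroup Γ₃] [LinearOrder Γ₃] [IsOrderedAddMonoid Γ₃]
    {ψ : HahnSeries Γ₂ k →+* HahnSeries Γ₃ k} {φ : HahnSeries Γ₁ k →+* HahnSeries Γ₂ k}
    (hψ : IsIntegralHom ψ) (hφ : IsIntegralHom φ) :
    IsIntegralHom (ψ.comp φ) where
  map_C c := by rw [RingHom.comp_apply, hφ.map_C, hψ.map_C]
  orderTop_nonneg p hp := hψ.orderTop_nonneg _ (hφ.orderTop_nonneg p hp)

/-- Integral homomorphisms on `k((x))` for which the image of `x` has positive order are determined
by the image of `x`: two of them differ on a power series by a multiple of every power of that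
image. -/
theorem IsIntegralHom.ext [Archimedean Γ] {φ ψ : LaurentSeries k →+* HahnSeries Γ k}
    (hφ : IsIntegralHom φ) (hψ : IsIntegralHom ψ)
    (hpos : 0 < (φ (HahnSeries.single 1 1)).orderTop)
    (h : φ (HahnSeries.single 1 1) = ψ (HahnSeries.single 1 1)) : φ = ψ := by
  refine IsLocalization.ringHom_ext (Submonoid.powers (PowerSeries.X : PowerSeries k))
    (RingHom.ext fun a => ?_)
  change φ (HahnSeries.ofPowerSeries ℤ k a) = ψ (HahnSeries.ofPowerSeries ℤ k a)
  set r := φ (HahnSeries.single 1 1) with hr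
  have hpoly (f : k[X]) : φ (HahnSeries.ofPowerSeries ℤ k f) =
      ψ (HahnSeries.ofPowerSeries ℤ k f) := by
    induction f using Polynomial.induction_on' with
    | add p q hp hq => simp [hp, hq]
    | monomial n c =>
      rw [← C_mul_X_pow_eq_monomial, Polynomial.coe_mul, Polynomial.coe_pow, Polynomial.coe_C,
        Polynomial.coe_X, map_mul, map_pow, HahnSeries.ofPowerSeries_C, HahnSeries.ofPowerSeries_X,
        map_mul, map_mul, map_pow, map_pow, hφ.map_C, hψ.map_C, ← hr, h]
  have hle (n : ℕ) : n • r.orderTop ≤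
      (φ (HahnSeries.ofPowerSeries ℤ k a) - ψ (HahnSeries.ofPowerSeries ℤ k a)).orderTop := by
    obtain ⟨b, hb⟩ : ∃ b : PowerSeries k, a = PowerSeries.X ^ n * b +
        ((PowerSeries.trunc n a : k[X]) : PowerSeries k) :=
      ⟨_, PowerSeries.eq_X_pow_mul_shift_add_trunc n a⟩
    rw [hb]
    simp only [map_add, map_mul, map_pow, HahnSeries.ofPowerSeries_X, hpoly]
    rw [← h, ← hr, add_sub_add_right_eq_sub, ← mul_sub, HahnSeries.orderTop_mul,
      orderTop_pow]
    refine le_add_of_nonneg_right (le_trans ?_ HahnSeries.min_orderTop_le_orderTop_sub)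
    exact le_min (hφ.orderTop_nonneg _ (orderTop_ofPowerSeries_nonneg b))
      (hψ.orderTop_nonneg _ (orderTop_ofPowerSeries_nonneg b))
  by_contra hne
  obtain ⟨d, hd⟩ := WithTop.ne_top_iff_exists.1 (HahnSeries.orderTop_ne_top.2 (sub_ne_zero.2 hne))
  have hr0 : r.orderTop ≠ ⊤ := by
    intro htop
    have := hle 1
    rw [htop, one_nsmul, ← hd] at this
    exact WithTop.coe_ne_top (top_le_iff.1 this)
  obtain ⟨e, he⟩ := WithTop.ne_top_iff_exists.1 hr0
  rw [← he] at hpos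
  obtain ⟨n, hn⟩ := Archimedean.arch (d + e) (y := e) (by exact_mod_cast hpos)
  have := hle n
  rw [← he, ← hd, ← WithTop.coe_nsmul, WithTop.coe_le_coe] at this
  exact absurd (hn.trans this) (not_le.2 (lt_add_of_pos_right d (by exact_mod_cast hpos)))

theorem IsIntegralHom.isPosOrder {φ : LaurentSeries k →+* HahnSeries Γ k} (hφ : IsIntegralHom φ)
    (hX : 0 < (φ (HahnSeries.single 1 1)).orderTop) {p : LaurentSeries k} (hp : IsPosOrder p) :
    IsPosOrder (φ p) := by
  refine ⟨(map_ne_zero φ).2 hp.1, ?_⟩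
  have hp' : p = HahnSeries.single 1 1 * (HahnSeries.single (-1) 1 * p) := by
    rw [← mul_assoc, HahnSeries.single_mul_single]
    simp
  have h1 : 0 ≤ (HahnSeries.single (-1) 1 * p).orderTop := by
    rw [HahnSeries.orderTop_mul, HahnSeries.orderTop_single one_ne_zero,
      ← HahnSeries.order_eq_orderTop_of_ne_zero hp.1]
    have := (HahnSeries.zero_lt_orderTop_iff hp.1).1 hp.2
    norm_cast
    omega
  rw [hp', map_mul, HahnSeries.orderTop_mul]
  exact add_pos_of_pos_of_nonneg hX (hφ.orderTop_nonneg _ h1)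

theorem isIntegralHom_ramify (N : ℕ+) : IsIntegralHom (ramify k N) where
  map_C _ := HahnSeries.embDomainRingHom_C
  orderTop_nonneg p hp := by
    rw [orderTop_ramify]
    cases h : p.orderTop with
    | top => exact le_top
    | coe a =>
      rw [h] at hp
      have ha : (0 : ℤ) ≤ a := by exact_mod_cast hp
      rw [WithTop.map_coe]
      exact_mod_cast mul_nonneg ha (Int.natCast_nonneg _)

theorem isIntegralHom_fracSubst (n : ℕ+) : IsIntegralHom (fracSubst k n) where
  map_C _ := HahnSeries.embDomainRingHom_C
  orderTop_nonneg p hp := by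
    rw [orderTop_fracSubst]
    cases h : p.orderTop with
    | top => exact le_top
    | coe a =>
      rw [h] at hp
      have ha : (0 : ℚ) ≤ a := by exact_mod_cast hp
      rw [WithTop.map_coe]
      exact_mod_cast mul_nonneg ha (by positivity)

theorem isPosOrder_fracSubst_iff {n : ℕ+} {p : LaurentSeries k} :
    IsPosOrder (fracSubst k n p) ↔ IsPosOrder p := by
  have hn : (0 : ℚ) < ((n : ℕ) : ℚ)⁻¹ := by positivity
  refine and_congr (map_ne_zero _) ?_
  rw [orderTop_fracSubst]
  cases p.orderTop with
  | top => simp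
  | coe a =>
    rw [WithTop.map_coe]
    norm_cast
    simp [hn]

theorem isUnit_heval_of_mem_powers {r : HahnSeries Γ k} (hr : IsPosOrder r)
    (y : Submonoid.powers (PowerSeries.X : PowerSeries k)) :
    IsUnit ((PowerSeries.heval r).toRingHom (y : PowerSeries k)) := by
  obtain ⟨-, n, rfl⟩ := y
  change IsUnit (PowerSeries.heval _ (PowerSeries.X ^ n))
  rw [map_pow, PowerSeries.heval_X _ hr.2]
  exact (isUnit_iff_ne_zero.2 hr.1).pow n

variable [Nontrivial Γ]

variable (k Γ) in
theorem exists_isPosOrder : ∃ r : HahnSeries Γ k, IsPosOrder r :=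
  let ⟨a, ha⟩ := exists_zero_lt (α := Γ)
  ⟨HahnSeries.single a 1, isPosOrder_single ha one_ne_zero⟩

open Classical in
/-- The ring homomorphism `p ↦ p(r)` on `k((x))`, for `r` nonzero of positive order. For every other
`r` it is the substitution of one fixed series of positive order, which makes `substHom r` a ring
homomorphism in all cases. -/
noncomputable def substHom (r : HahnSeries Γ k) : LaurentSeries k →+* HahnSeries Γ k :=
  if hr : IsPosOrder r then
    IsLocalization.lift (M := Submonoid.powers (PowerSeries.X : PowerSeries k))
      (isUnit_heval_of_mem_powers hr)
  else
    IsLocalization.lift (M := Submonoid.powers (PowerSeries.X : PowerSeries k))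
      (isUnit_heval_of_mem_powers (exists_isPosOrder k Γ).choose_spec)

theorem substHom_ofPowerSeries {r : HahnSeries Γ k} (hr : IsPosOrder r) (a : PowerSeries k) :
    substHom r (HahnSeries.ofPowerSeries ℤ k a) = PowerSeries.heval r a := by
  rw [substHom, dif_pos hr]
  exact IsLocalization.lift_eq (isUnit_heval_of_mem_powers hr) a

theorem substHom_X {r : HahnSeries Γ k} (hr : IsPosOrder r) :
    substHom r (HahnSeries.single 1 1) = r := by
  rw [← HahnSeries.ofPowerSeries_X, substHom_ofPowerSeries hr, PowerSeries.heval_X _ hr.2]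

theorem substHom_C {r : HahnSeries Γ k} (hr : IsPosOrder r) (c : k) :
    substHom r (HahnSeries.C c) = HahnSeries.C c := by
  rw [← HahnSeries.ofPowerSeries_C, substHom_ofPowerSeries hr, PowerSeries.heval_C,
    HahnSeries.C_eq_algebraMap, Algebra.algebraMap_eq_smul_one]

theorem laurentSubst_eq_substHom {r : HahnSeries ℚ k} (hr : IsPosOrder r) (p : LaurentSeries k) :
    laurentSubst p r = substHom r p := by
  conv_rhs => rw [← LaurentSeries.single_order_mul_powerSeriesPart p]
  rw [map_mul, substHom_ofPowerSeries hr, RatFunc.single_zpow, map_zpow₀, substHom_X hr]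
  rfl

theorem isIntegralHom_substHom {r : HahnSeries Γ k} (hr : IsPosOrder r) :
    IsIntegralHom (substHom r) where
  map_C := substHom_C hr
  orderTop_nonneg p hp := by
    obtain ⟨a, rfl⟩ := exists_ofPowerSeries_eq hp
    rw [substHom_ofPowerSeries hr]
    exact orderTop_heval_nonneg hr.2 a

theorem isPosOrder_substHom {r : HahnSeries Γ k} (hr : IsPosOrder r) {p : LaurentSeries k}
    (hp : IsPosOrder p) : IsPosOrder (substHom r p) :=
  (isIntegralHom_substHom hr).isPosOrder (by rw [substHom_X hr]; exact hr.2) hp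

/-- An integral homomorphism that sends `x` to `r` is the substitution of `r`. -/
theorem IsIntegralHom.eq_substHom [Archimedean Γ] {φ : LaurentSeries k →+* HahnSeries Γ k}
    (hφ : IsIntegralHom φ) {r : HahnSeries Γ k} (hr : IsPosOrder r)
    (hX : φ (HahnSeries.single 1 1) = r) : φ = substHom r :=
  hφ.ext (isIntegralHom_substHom hr) (hX ▸ hr.2) (hX.trans (substHom_X hr).symm)

/-- `p(r ^ N)` is the value at `r` of `p(t ^ N)`. -/
theorem substHom_comp_ramify [Archimedean Γ] {r : HahnSeries Γ k} (hr : IsPosOrder r) (N : ℕ+) :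
    (substHom r).comp (ramify k N) = substHom (r ^ (N : ℕ)) := by
  refine ((isIntegralHom_substHom hr).comp (isIntegralHom_ramify N)).eq_substHom (hr.pow N) ?_
  rw [RingHom.comp_apply, ramify_single, one_mul, RatFunc.single_zpow, map_zpow₀, substHom_X hr,
    zpow_natCast]

/-- Substitution is associative. -/
theorem substHom_comp_substHom [Archimedean Γ] {r : HahnSeries Γ k} (hr : IsPosOrder r)
    {q : LaurentSeries k} (hq : IsPosOrder q) :
    (substHom r).comp (substHom q) = substHom (substHom r q) :=
  ((isIntegralHom_substHom hr).comp (isIntegralHom_substHom hq)).eq_substHom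
    (isPosOrder_substHom hr hq) (by rw [RingHom.comp_apply, substHom_X hq])

theorem fracSubst_eq_substHom (n : ℕ+) :
    fracSubst k n = substHom (HahnSeries.single ((n : ℚ)⁻¹) 1) :=
  (isIntegralHom_fracSubst n).eq_substHom (isPosOrder_single (by positivity) one_ne_zero)
    (by simp [fracSubst_single])

theorem fracSubst_one_eq_substHom : fracSubst k 1 = substHom (HahnSeries.single 1 1) := by
  simpa using fracSubst_eq_substHom (k := k) 1

theorem fracSubst_comp_substHom (n : ℕ+) {q : LaurentSeries k} (hq : IsPosOrder q) :
    (fracSubst k n).comp (substHom q) = substHom (fracSubst k n q) := by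
  rw [fracSubst_eq_substHom,
    substHom_comp_substHom (isPosOrder_single (by positivity) one_ne_zero) hq]

end Subst

/-! ### Descent to `k((x))` -/

section Descent

variable {k : Type*} [Field k]

/-- Characters of `ℚ / ℤ` with values in `kˣ` separate points, as `kˣ` is divisible and contains
primitive roots of unity of every order. -/
theorem exists_character_ne_zero [IsAlgClosed k] [CharZero k] {a : ℚ}
    (ha : a ∉ Set.range ((↑) : ℤ → ℚ)) : ∃ χ : ℚ →+ Additive kˣ, χ 1 = 0 ∧ χ a ≠ 0 := by
  have : NeZero a.den := ⟨a.den_nz⟩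
  have : NeZero (a.den : k) := ⟨by exact_mod_cast a.den_nz⟩
  have hd : (a.den : ℚ) ≠ 0 := by exact_mod_cast a.den_nz
  obtain ⟨z, hz⟩ := HasEnoughRootsOfUnity.exists_primitiveRoot k a.den
  obtain ⟨ζ, rfl⟩ := hz.isUnit a.den_nz
  rw [IsPrimitiveRoot.coe_units_iff] at hz
  have hroot {n : ℕ} (hn : n ≠ 0) :
      Function.Surjective (fun u : Additive kˣ => n • u) := fun u => by
    obtain ⟨w, hw⟩ := IsAlgClosed.exists_pow_nat_eq (u.toMul : k) (Nat.pos_of_ne_zero hn)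
    have hw0 : w ≠ 0 := fun h => u.toMul.ne_zero (by rw [← hw, h, zero_pow hn])
    exact ⟨Additive.ofMul (Units.mk0 w hw0), congrArg Additive.ofMul (Units.ext hw)⟩
  let : DivisibleBy (Additive kˣ) ℕ := 
    divisibleByOfSMulRightSurj _ _ (fun hn => hroot hn)
  let : DivisibleBy (Additive kˣ) ℤ := AddGroup.divisibleByIntOfDivisibleByNat _
  obtain ⟨χ, hχ⟩ := (Module.Baer.of_divisible (Additive kˣ)).extension_property_addMonoidHom
    (zmultiplesHom ℚ ((a.den : ℚ)⁻¹)) (fun m n h => by simpa [hd] using h)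
    (zmultiplesHom (Additive kˣ) (Additive.ofMul ζ))
  have key (n : ℤ) : χ (n * (a.den : ℚ)⁻¹) = n • Additive.ofMul ζ := by
    simpa using DFunLike.congr_fun hχ n
  refine ⟨χ, ?_, fun h => ha ?_⟩
  · have := key a.den
    rw [Int.cast_natCast, mul_inv_cancel₀ hd] at this
    rw [this, ← ofMul_zpow, zpow_natCast, hz.pow_eq_one, ofMul_one]
  · have h1 := key a.num
    rw [← div_eq_mul_inv, Rat.num_div_den, h, ← ofMul_zpow] at h1
    have h2 : ζ ^ a.num = 1 := (Additive.ofMul.injective h1).symm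
    have h3 := Int.natAbs_dvd_natAbs.2 ((hz.zpow_eq_one_iff_dvd _).1 h2)
    have h4 : a.den = 1 := Nat.eq_one_of_dvd_coprimes a.reduced.symm dvd_rfl (by simpa using h3)
    exact ⟨a.num, by rw [Rat.coe_int_num_of_den_eq_one h4]⟩

/-- The conjugation `x ^ a ↦ χ(a) x ^ a` of generalized power series by a character of the group of
exponents. -/
noncomputable def twist (χ : ℚ →+ Additive kˣ) : HahnSeries ℚ k →+* HahnSeries ℚ k where
  toFun x := ⟨fun a => ((χ a).toMul : k) * x.coeff a,
    x.isPWO_support.mono fun a ha h => ha (by simp [show x.coeff a = 0 by simpa using h])⟩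
  map_one' := by
    ext a
    by_cases ha : a = 0 <;> simp [HahnSeries.coeff_one, ha]
  map_zero' := by
    ext a
    simp
  map_add' x y := by
    ext a
    simp [mul_add]
  map_mul' x y := by
    ext a
    have hsupp (z : HahnSeries ℚ k) : Function.support (fun a => ((χ a).toMul : k) * z.coeff a) =
        Function.support z.coeff := by
      ext b
      simp
    simp only [HahnSeries.coeff_mul, Finset.mul_sum]
    refine Finset.sum_congr (by ext; simp [HahnSeries.support])
      fun i hi => ?_
    rw [← (Finset.mem_antidiagonal.1 hi).2.2, map_add, toMul_add, Units.val_mul]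
    ring

@[simp]
theorem coeff_twist (χ : ℚ →+ Additive kˣ) (x : HahnSeries ℚ k) (a : ℚ) :
    (twist χ x).coeff a = ((χ a).toMul : k) * x.coeff a :=
  rfl

theorem orderTop_twist (χ : ℚ →+ Additive kˣ) (x : HahnSeries ℚ k) :
    (twist χ x).orderTop = x.orderTop := by
  refine eq_of_forall_le_iff fun i => ?_
  simp [HahnSeries.le_orderTop_iff_forall]

theorem isIntegralHom_twist (χ : ℚ →+ Additive kˣ) : IsIntegralHom (twist χ) where
  map_C c := by
    ext a
    by_cases ha : a = 0 <;> simp [HahnSeries.C_apply, ha]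
  orderTop_nonneg p hp := by rwa [orderTop_twist]

theorem IsPosOrder.twist {r : HahnSeries ℚ k} (hr : IsPosOrder r) (χ : ℚ →+ Additive kˣ) :
    IsPosOrder (twist χ r) :=
  ⟨(_root_.map_ne_zero _).2 hr.1, by rw [orderTop_twist]; exact hr.2⟩

theorem twist_comp_substHom (χ : ℚ →+ Additive kˣ) {r : HahnSeries ℚ k} (hr : IsPosOrder r) :
    (twist χ).comp (substHom r) = substHom (twist χ r) :=
  ((isIntegralHom_twist χ).comp (isIntegralHom_substHom hr)).eq_substHom (hr.twist χ)
    (by rw [RingHom.comp_apply, substHom_X hr])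

theorem twist_comp_fracSubst_one {χ : ℚ →+ Additive kˣ} (hχ : χ 1 = 0) :
    (twist χ).comp (fracSubst k 1) = fracSubst k 1 := by
  have h1 : IsPosOrder (HahnSeries.single (1 : ℚ) (1 : k)) :=
    isPosOrder_single one_pos one_ne_zero
  rw [fracSubst_one_eq_substHom, twist_comp_substHom χ h1]
  congr 1
  ext a
  by_cases ha : a = 1 <;> simp [ha, hχ]

/-- A generalized power series that is fixed by all conjugations trivial on integral exponents is a
Laurent series. -/
theorem mem_range_fracSubst_one [IsAlgClosed k] [CharZero k] {x : HahnSeries ℚ k}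
    (hx : ∀ χ : ℚ →+ Additive kˣ, χ 1 = 0 → twist χ x = x) :
    ∃ p : LaurentSeries k, fracSubst k 1 p = x := by
  have hsupp {a : ℚ} (ha : x.coeff a ≠ 0) : a ∈ Set.range ((↑) : ℤ → ℚ) := by
    by_contra hr
    obtain ⟨χ, h1, h2⟩ := exists_character_ne_zero (k := k) hr
    have h3 : ((χ a).toMul : k) * x.coeff a = x.coeff a := by
      rw [← coeff_twist, hx χ h1]
    exact h2 (Additive.toMul.injective (Units.ext ((mul_eq_right₀ ha).1 h3)))
  refine ⟨HahnSeries.ofSuppBddBelow (fun n : ℤ => x.coeff n) ⟨⌊x.order⌋, fun n hn => ?_⟩, ?_⟩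
  · have : x.order ≤ (n : ℚ) := HahnSeries.order_le_of_coeff_ne_zero hn
    exact_mod_cast (Int.floor_le _).trans this
  · ext a
    have hcoeff (p : LaurentSeries k) (n : ℤ) : (fracSubst k 1 p).coeff n = p.coeff n := by
      have hn : (n : ℚ) = n * (((1 : ℕ+) : ℕ) : ℚ)⁻¹ := by simp
      rw [hn]
      exact HahnSeries.embDomain_mk_coeff (f := fun n : ℤ => (n : ℚ) * (((1 : ℕ+) : ℕ) : ℚ)⁻¹) _ _
    by_cases ha : a ∈ Set.range ((↑) : ℤ → ℚ)
    · obtain ⟨n, rfl⟩ := ha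
      rw [hcoeff]
      rfl
    · rw [by_contra fun h => ha (hsupp h)]
      refine HahnSeries.embDomain_of_notMem_range fun ⟨n, hn⟩ => ha ⟨n, ?_⟩
      rw [← hn]
      simp

theorem toFrac_injective : Function.Injective (toFrac (k := k)) :=
  Polynomial.map_injective _ (fracSubst k 1).injective

theorem map_twist_toFrac {χ : ℚ →+ Additive kˣ} (hχ : χ 1 = 0) (f : (LaurentSeries k)[X]) :
    (toFrac f).map (twist χ) = toFrac f := by
  rw [toFrac, Polynomial.map_map, twist_comp_fracSubst_one hχ]

/-- A monic polynomial that is fixed by all conjugations trivial on integral exponents comes from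
`k((x))[y]`. -/
theorem exists_monic_toFrac_eq [IsAlgClosed k] [CharZero k] {F : (HahnSeries ℚ k)[X]}
    (hF : F.Monic) (h : ∀ χ : ℚ →+ Additive kˣ, χ 1 = 0 → F.map (twist χ) = F) :
    ∃ f : (LaurentSeries k)[X], toFrac f = F ∧ f.natDegree = F.natDegree ∧ f.Monic :=
  lifts_and_natDegree_eq_and_monic ((lifts_iff_coeff_lifts (f := fracSubst k 1) F).2 fun i =>
    mem_range_fracSubst_one fun χ hχ => by rw [← coeff_map, h χ hχ]) hF

end Descent

/-! ### Puiseux roots -/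

section Roots

variable {k : Type*} [Field k]

/-- The multiset of the Puiseux roots of `f`, as generalized power series in `x`. -/
noncomputable def puiseuxRoots (f : (LaurentSeries k)[X]) : Multiset (HahnSeries ℚ k) :=
  (toFrac f).roots

theorem monic_toFrac {f : (LaurentSeries k)[X]} (hf : f.Monic) : (toFrac f).Monic :=
  hf.map _

theorem natDegree_toFrac (f : (LaurentSeries k)[X]) : (toFrac f).natDegree = f.natDegree :=
  natDegree_map _

theorem map_fracSubst_map_ramify (n : ℕ+) (f : (LaurentSeries k)[X]) :
    (f.map (ramify k n)).map (fracSubst k n) = toFrac f := by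
  rw [Polynomial.map_map, fracSubst_comp_ramify_self, toFrac]

theorem isPuiseuxExpansion_iff {f : (LaurentSeries k)[X]} {m : ℕ} {n : ℕ+}
    {p : Fin m → LaurentSeries k} :
    IsPuiseuxExpansion f n p ↔ f.map (ramify k n) = ∏ i, (X - C (p i)) := by
  rw [IsPuiseuxExpansion, ← map_fracSubst_map_ramify n,
    ← (Polynomial.map_injective _ (fracSubst k n).injective).eq_iff (b := ∏ i, (X - C (p i)))]
  simp [Polynomial.map_prod]

theorem roots_prod_univ_X_sub_C {R ι : Type*} [CommRing R] [IsDomain R] [Fintype ι] (a : ι → R) :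
    (∏ i, (X - C (a i))).roots = Finset.univ.val.map a := by
  have := roots_multiset_prod_X_sub_C (Finset.univ.val.map a)
  rwa [Multiset.map_map] at this

theorem puiseuxRoots_eq {f : (LaurentSeries k)[X]} {m : ℕ} {n : ℕ+}
    {p : Fin m → LaurentSeries k} (h : IsPuiseuxExpansion f n p) :
    puiseuxRoots f = Finset.univ.val.map fun i => fracSubst k n (p i) := by
  rw [puiseuxRoots, h, roots_prod_univ_X_sub_C]

theorem exists_isPuiseuxExpansion [IsAlgClosed k] [CharZero k] {f : (LaurentSeries k)[X]}
    (hf : f.Monic) :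
    ∃ (m : ℕ) (n : ℕ+) (p : Fin m → LaurentSeries k), IsPuiseuxExpansion f n p := by
  obtain ⟨n, hn⟩ := splitsAfterRamification f hf
  refine ⟨_, n, (f.map (ramify k n)).roots.toList.get, isPuiseuxExpansion_iff.2 ?_⟩
  conv_lhs => rw [hn.eq_prod_roots_of_monic (hf.map _), ← Multiset.coe_toList (roots _)]
  rw [Multiset.map_coe, Multiset.prod_coe]
  exact (Fin.prod_univ_fun_getElem _ _).symm

theorem toFrac_splits [IsAlgClosed k] [CharZero k] {f : (LaurentSeries k)[X]} (hf : f.Monic) :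
    (toFrac f).Splits := by
  obtain ⟨n, hn⟩ := splitsAfterRamification f hf
  rw [← map_fracSubst_map_ramify n]
  exact hn.map _

theorem prod_puiseuxRoots [IsAlgClosed k] [CharZero k] {f : (LaurentSeries k)[X]} (hf : f.Monic) :
    ((puiseuxRoots f).map fun a => X - C a).prod = toFrac f :=
  ((toFrac_splits hf).eq_prod_roots_of_monic (monic_toFrac hf)).symm

theorem card_puiseuxRoots [IsAlgClosed k] [CharZero k] {f : (LaurentSeries k)[X]} (hf : f.Monic) :
    (puiseuxRoots f).card = f.natDegree := by
  rw [← natDegree_toFrac, (toFrac_splits hf).natDegree_eq_card_roots, puiseuxRoots]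

theorem eq_of_puiseuxRoots_eq [IsAlgClosed k] [CharZero k] {f g : (LaurentSeries k)[X]}
    (hf : f.Monic) (hg : g.Monic) (h : puiseuxRoots f = puiseuxRoots g) : f = g :=
  toFrac_injective (by rw [← prod_puiseuxRoots hf, ← prod_puiseuxRoots hg, h])

theorem map_twist_puiseuxRoots [IsAlgClosed k] [CharZero k] {f : (LaurentSeries k)[X]}
    (hf : f.Monic) {χ : ℚ →+ Additive kˣ} (hχ : χ 1 = 0) :
    (puiseuxRoots f).map (twist χ) = puiseuxRoots f := by
  rw [puiseuxRoots, ← (toFrac_splits hf).roots_map_of_injective (twist χ).injective,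
    map_twist_toFrac hχ]

theorem puiseuxRoots_X_sub_C (c : LaurentSeries k) :
    puiseuxRoots (X - C c) = {fracSubst k 1 c} := by
  rw [puiseuxRoots, toFrac, Polynomial.map_sub, map_X, map_C, roots_X_sub_C]

theorem X_sub_C_mem_MSet (c : LaurentSeries k) : X - C c ∈ MSet k :=
  ⟨monic_X_sub_C c, by rw [natDegree_X_sub_C]; exact one_pos⟩

end Roots

/-! ### Composition of roots by a binary operation -/

section Binary

variable {k : Type*} [Field k]

/-- `h = ∏ i, ∏ j, (y - β (p i (x^(1/n₁))) (q j (x^(1/n₂))))` for some Puiseux expansions of `f` and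
`g`: the common form of the composed sum and of the composed multiplication. -/
def IsComposedBy (β : HahnSeries ℚ k → HahnSeries ℚ k → HahnSeries ℚ k)
    (f g h : (LaurentSeries k)[X]) : Prop :=
  ∃ (m₁ m₂ : ℕ) (n₁ n₂ : ℕ+) (p : Fin m₁ → LaurentSeries k) (q : Fin m₂ → LaurentSeries k),
    IsPuiseuxExpansion f n₁ p ∧ IsPuiseuxExpansion g n₂ q ∧
    toFrac h = ∏ i, ∏ j, (X - C (β (fracSubst k n₁ (p i)) (fracSubst k n₂ (q j))))

variable {β : HahnSeries ℚ k → HahnSeries ℚ k → HahnSeries ℚ k}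

theorem prod_prod_X_sub_C {m₁ m₂ : ℕ} (a : Fin m₁ → HahnSeries ℚ k)
    (b : Fin m₂ → HahnSeries ℚ k) :
    ∏ i, ∏ j, (X - C (β (a i) (b j))) =
      ((((Finset.univ.val.map a).bind fun x => (Finset.univ.val.map b).map (β x))).map
        fun x => X - C x).prod := by
  simp only [Multiset.map_bind, Multiset.prod_bind, Multiset.bind_map, Multiset.map_map,
    Finset.prod_eq_multiset_prod, Function.comp_def]

variable [IsAlgClosed k] [CharZero k]

theorem isComposedBy_iff {f g h F : (LaurentSeries k)[X]} (hf : f.Monic) (hg : g.Monic)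
    (hF : F.Monic)
    (hroots : puiseuxRoots F = (puiseuxRoots f).bind fun a => (puiseuxRoots g).map (β a)) :
    IsComposedBy β f g h ↔ h = F := by
  constructor
  · rintro ⟨m₁, m₂, n₁, n₂, p, q, hp, hq, hh⟩
    refine toFrac_injective ?_
    rw [hh, prod_prod_X_sub_C, ← puiseuxRoots_eq hp, ← puiseuxRoots_eq hq, ← hroots,
      prod_puiseuxRoots hF]
  · rintro rfl
    obtain ⟨m₁, n₁, p, hp⟩ := exists_isPuiseuxExpansion hf
    obtain ⟨m₂, n₂, q, hq⟩ := exists_isPuiseuxExpansion hg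
    refine ⟨m₁, m₂, n₁, n₂, p, q, hp, hq, ?_⟩
    rw [prod_prod_X_sub_C, ← puiseuxRoots_eq hp, ← puiseuxRoots_eq hq, ← hroots,
      prod_puiseuxRoots hF]

/-- The roots of `f` and `g`, composed by an operation that commutes with conjugation, are the roots
of a polynomial over `k((x))`. -/
theorem exists_puiseuxRoots_eq_bind
    (hβ : ∀ χ : ℚ →+ Additive kˣ, ∀ a b, twist χ (β a b) = β (twist χ a) (twist χ b))
    (f g : MSet k) : ∃ F : MSet k, puiseuxRoots F.1 =
      (puiseuxRoots f.1).bind fun a => (puiseuxRoots g.1).map (β a) := by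
  obtain ⟨f, hf, hfd⟩ := f
  obtain ⟨g, hg, hgd⟩ := g
  set A := (puiseuxRoots f).bind fun a => (puiseuxRoots g).map (β a) with hA
  have hmonic : (A.map fun a => X - C a).prod.Monic := monic_multiset_prod_of_monic _ _
    fun a _ => monic_X_sub_C a
  obtain ⟨F, hF, hFd, hFm⟩ := exists_monic_toFrac_eq hmonic fun χ hχ => by
    have hAχ : A.map (twist χ) = A := by
      have h1 (a) : ((puiseuxRoots g).map (β a)).map (twist χ) =
          (puiseuxRoots g).map (β (twist χ a)) := by
        conv_rhs => rw [← map_twist_puiseuxRoots hg hχ]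
        simp [Multiset.map_map, hβ]
      rw [hA, Multiset.map_bind]
      simp only [h1]
      rw [← Multiset.bind_map (puiseuxRoots f) (fun a => (puiseuxRoots g).map (β a)) (twist χ),
        map_twist_puiseuxRoots hf hχ]
    conv_rhs => rw [← hAχ]
    rw [Polynomial.map_multiset_prod, Multiset.map_map, Multiset.map_map]
    simp
  refine ⟨⟨F, hFm, ?_⟩, ?_⟩
  · rw [hFd, natDegree_multiset_prod_X_sub_C_eq_card, hA, Multiset.card_bind]
    simp [card_puiseuxRoots, hf, hg, hfd, hgd]
  · change puiseuxRoots F = A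
    rw [puiseuxRoots, hF, roots_multiset_prod_X_sub_C]

/-- A commutative monoid structure on series that commutes with conjugation induces a commutative
monoid structure on `𝕄`. -/
theorem exists_composedBy_commMonoid
    (hβ : ∀ χ : ℚ →+ Additive kˣ, ∀ a b, twist χ (β a b) = β (twist χ a) (twist χ b))
    (hassoc : ∀ a b c, β (β a b) c = β a (β b c)) (hcomm : ∀ a b, β a b = β b a)
    {E : (LaurentSeries k)[X]} {c : LaurentSeries k} (hE : E = X - C c)
    (hc : ∀ a, β (fracSubst k 1 c) a = a) :
    ∃ op : MSet k → MSet k → MSet k,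
      (∀ (f g : MSet k) (h : (LaurentSeries k)[X]), IsComposedBy β f.1 g.1 h ↔ h = (op f g).1) ∧
      (∀ f g h, op (op f g) h = op f (op g h)) ∧ (∀ f g, op f g = op g f) ∧
      ∃ e : MSet k, e.1 = E ∧ ∀ f, op e f = f ∧ op f e = f := by
  subst hE
  choose op hop using exists_puiseuxRoots_eq_bind hβ
  have hext {f g : MSet k} (h : puiseuxRoots f.1 = puiseuxRoots g.1) : f = g :=
    Subtype.ext (eq_of_puiseuxRoots_eq f.2.1 g.2.1 h)
  have hcom (f g : MSet k) : op f g = op g f := hext <| by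
    rw [hop, hop, Multiset.bind_map_comm]
    simp only [hcomm]
  have hid (f : MSet k) : op ⟨X - C c, X_sub_C_mem_MSet c⟩ f = f := hext <| by
    rw [hop, puiseuxRoots_X_sub_C, Multiset.singleton_bind]
    simp [hc]
  refine ⟨op, fun f g h => isComposedBy_iff f.2.1 g.2.1 (op f g).2.1 (hop f g),
    fun f g h => hext ?_, hcom, ⟨_, X_sub_C_mem_MSet c⟩, rfl, fun f => ⟨hid f, ?_⟩⟩
  · simp only [hop, Multiset.bind_assoc, Multiset.bind_map, Multiset.map_bind, Multiset.map_map,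
      Function.comp_def, hassoc]
  · rw [hcom, hid]

end Binary

/-! ### The composed product -/

section Product

variable {k : Type*} [Field k]

/-- The product of the polynomials `f(s, y)` over the series `s` in `A`. For `A` the Puiseux
roots of `g`, this is the composed product of `f` and `g`. -/
noncomputable def prodSubst (f : (LaurentSeries k)[X]) (A : Multiset (HahnSeries ℚ k)) :
    (HahnSeries ℚ k)[X] :=
  (A.map fun s => f.map (substHom s)).prod

theorem monic_prodSubst {f : (LaurentSeries k)[X]} (hf : f.Monic)
    (A : Multiset (HahnSeries ℚ k)) : (prodSubst f A).Monic :=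
  monic_multiset_prod_of_monic _ _ fun _ _ => hf.map _

theorem roots_prodSubst {f : (LaurentSeries k)[X]} (hf : f.Monic)
    (A : Multiset (HahnSeries ℚ k)) :
    (prodSubst f A).roots = A.bind fun s => (f.map (substHom s)).roots := by
  rw [prodSubst, roots_multiset_prod, Multiset.bind_map]
  rw [Multiset.mem_map]
  rintro ⟨s, -, hs⟩
  exact (hf.map _).ne_zero hs

/-- `f(r ^ n, y) = ∏ i, (y - p i (r))`: this is why the composed product depends neither on the
expansion of `f` nor on the choice of the `n`-th roots. -/
theorem map_substHom_pow {f : (LaurentSeries k)[X]} {m : ℕ} {n : ℕ+}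
    {p : Fin m → LaurentSeries k} (hp : IsPuiseuxExpansion f n p) {r : HahnSeries ℚ k}
    (hr : IsPosOrder r) :
    f.map (substHom (r ^ (n : ℕ))) = ∏ i, (X - C (substHom r (p i))) := by
  rw [← substHom_comp_ramify hr, ← Polynomial.map_map, isPuiseuxExpansion_iff.1 hp]
  simp [Polynomial.map_prod]

/-- The product that defines the composed product, for any choice of expansions and roots, is the
product of the `f(s, y)` over the Puiseux roots `s` of `g`. -/
theorem prod_map_substHom {f g : (LaurentSeries k)[X]} {m₁ m₂ : ℕ} {n₁ n₂ : ℕ+}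
    {p : Fin m₁ → LaurentSeries k} {q : Fin m₂ → LaurentSeries k} {r : Fin m₂ → HahnSeries ℚ k}
    (hp : IsPuiseuxExpansion f n₁ p) (hq : IsPuiseuxExpansion g n₂ q)
    (hq0 : ∀ j, IsPosOrder (q j)) (hr : ∀ j, r j ^ (n₁ : ℕ) = fracSubst k n₂ (q j)) :
    ∏ i, ∏ j, (X - C (laurentSubst (p i) (r j))) = prodSubst f (puiseuxRoots g) := by
  have hrpos (j) : IsPosOrder (r j) :=
    .of_pow n₁.ne_zero (by rw [hr]; exact isPosOrder_fracSubst_iff.2 (hq0 j))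
  rw [prodSubst, puiseuxRoots_eq hq, Multiset.map_map, Finset.prod_comm,
    Finset.prod_eq_multiset_prod]
  congr 1
  refine Multiset.map_congr rfl fun j _ => ?_
  rw [Function.comp_apply, ← hr, map_substHom_pow hp (hrpos j)]
  exact Finset.prod_congr rfl fun i _ => by rw [laurentSubst_eq_substHom (hrpos j)]

variable [IsAlgClosed k] [CharZero k]

theorem mem_MStarSet_iff {f : (LaurentSeries k)[X]} :
    f ∈ MStarSet k ↔ f ∈ MSet k ∧ ∀ a ∈ puiseuxRoots f, IsPosOrder a := by
  refine and_congr_right fun hf => ⟨?_, fun h => ?_⟩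
  · rintro ⟨m, n, p, hp, hpos⟩ a ha
    rw [puiseuxRoots_eq hp] at ha
    obtain ⟨i, -, rfl⟩ := Multiset.mem_map.1 ha
    exact isPosOrder_fracSubst_iff.2 (hpos i).isPosOrder
  · obtain ⟨m, n, p, hp⟩ := exists_isPuiseuxExpansion hf.1
    refine ⟨m, n, p, hp, fun i => (isPosOrder_fracSubst_iff (n := n).1
      (h _ ?_)).isNonconstVanishing⟩
    rw [puiseuxRoots_eq hp]
    exact Multiset.mem_map_of_mem _ (Finset.mem_univ_val i)

/-- A Puiseux series has roots of every order, by Puiseux's theorem for `y ^ N - q`. -/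
theorem exists_pow_eq_fracSubst (n N : ℕ+) (q : LaurentSeries k) :
    ∃ r : HahnSeries ℚ k, r ^ (N : ℕ) = fracSubst k n q := by
  obtain ⟨M, hM⟩ := splitsAfterRamification (X ^ (N : ℕ) - C q) (monic_X_pow_sub_C q N.ne_zero)
  obtain ⟨w, hw⟩ := hM.exists_eval_eq_zero (by
    rw [degree_map, degree_X_pow_sub_C N.pos]
    exact_mod_cast N.ne_zero)
  refine ⟨fracSubst k (n * M) w, ?_⟩
  rw [← map_pow, ← fracSubst_comp_ramify n M, RingHom.comp_apply]
  congr 1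
  simpa [sub_eq_zero] using hw

theorem exists_pow_eq_of_mem_puiseuxRoots {g : (LaurentSeries k)[X]} (hg : g ∈ MStarSet k)
    {s : HahnSeries ℚ k} (hs : s ∈ puiseuxRoots g) (N : ℕ+) :
    ∃ r : HahnSeries ℚ k, IsPosOrder r ∧ r ^ (N : ℕ) = s := by
  have hpos := (mem_MStarSet_iff.1 hg).2 s hs
  obtain ⟨m, n, p, hp⟩ := exists_isPuiseuxExpansion hg.1.1
  rw [puiseuxRoots_eq hp] at hs
  obtain ⟨i, -, rfl⟩ := Multiset.mem_map.1 hs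
  obtain ⟨r, hr⟩ := exists_pow_eq_fracSubst n N (p i)
  exact ⟨r, .of_pow N.ne_zero (hr ▸ hpos), hr⟩

/-- The composed product of two elements of `𝕄*` exists in `𝕄*`. -/
theorem exists_toFrac_eq_prodSubst (f g : MStarSet k) :
    ∃ F : MStarSet k, toFrac F.1 = prodSubst f.1 (puiseuxRoots g.1) := by
  obtain ⟨f, hf⟩ := f
  obtain ⟨g, hg⟩ := g
  change ∃ F : MStarSet k, toFrac F.1 = prodSubst f (puiseuxRoots g)
  have hg' := (mem_MStarSet_iff.1 hg).2
  obtain ⟨F, hF, hFd, hFm⟩ := exists_monic_toFrac_eq (monic_prodSubst hf.1.1 (puiseuxRoots g))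
    fun χ hχ => by
      conv_rhs => rw [← map_twist_puiseuxRoots hg.1.1 hχ]
      rw [prodSubst, prodSubst, Polynomial.map_multiset_prod, Multiset.map_map, Multiset.map_map]
      congr 1
      refine Multiset.map_congr rfl fun s hs => ?_
      rw [Function.comp_apply, Function.comp_apply, Polynomial.map_map,
        twist_comp_substHom χ (hg' s hs)]
  refine ⟨⟨F, mem_MStarSet_iff.2 ⟨⟨hFm, ?_⟩, fun a ha => ?_⟩⟩, hF⟩
  -- In degree zero, the factor `f(s, y)` for a root `s` of `g` would be a unit.
  · obtain ⟨s, hs⟩ := Multiset.card_pos_iff_exists_mem.1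
      ((card_puiseuxRoots hg.1.1).symm ▸ hg.1.2)
    refine Nat.pos_of_ne_zero fun h0 => hf.1.2.ne' ?_
    have h1 : F = 1 := hFm.natDegree_eq_zero.1 h0
    have h2 : f.map (substHom s) ∣ 1 := by
      have := Multiset.dvd_prod (Multiset.mem_map_of_mem (fun s => f.map (substHom s)) hs)
      rwa [← prodSubst, ← hF, h1, toFrac, Polynomial.map_one] at this
    rw [← hf.1.1.natDegree_map (substHom s)]
    exact natDegree_eq_zero_of_isUnit (isUnit_of_dvd_one h2)
  · rw [puiseuxRoots, hF, roots_prodSubst hf.1.1, Multiset.mem_bind] at ha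
    obtain ⟨s, hs, ha⟩ := ha
    obtain ⟨m, n, p, hp, hpos⟩ := hf.2
    obtain ⟨r, hr, rfl⟩ := exists_pow_eq_of_mem_puiseuxRoots hg hs n
    rw [map_substHom_pow hp hr, mem_roots'] at ha
    obtain ⟨i, -, hi⟩ := Finset.prod_eq_zero_iff.1 ((eval_prod _ _ _).symm.trans ha.2)
    rw [eval_sub, eval_X, eval_C, sub_eq_zero] at hi
    exact hi ▸ isPosOrder_substHom hr (hpos i).isPosOrder

theorem isComposedProd_iff {f g h F : (LaurentSeries k)[X]} (hf : f ∈ MStarSet k)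
    (hg : g ∈ MStarSet k) (hF : toFrac F = prodSubst f (puiseuxRoots g)) :
    IsComposedProd f g h ↔ h = F := by
  constructor
  · rintro ⟨m₁, m₂, n₁, n₂, p, q, r, hp, hq, -, hq0, hr, hh⟩
    refine toFrac_injective ?_
    rw [hh, hF, prod_map_substHom hp hq (fun j => (hq0 j).isPosOrder) hr]
  · rintro rfl
    obtain ⟨-, m₁, n₁, p, hp, hp0⟩ := hf
    obtain ⟨-, m₂, n₂, q, hq, hq0⟩ := hg
    choose r hr using fun j => exists_pow_eq_fracSubst n₂ n₁ (q j)
    refine ⟨m₁, m₂, n₁, n₂, p, q, r, hp, hq, hp0, hq0, hr, ?_⟩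
    rw [hF, prod_map_substHom hp hq (fun j => (hq0 j).isPosOrder) hr]

/-- Substituting `s = r ^ n` in the composed product of `f` and `g`, where `g` has roots
`q j (x^(1/n))`, amounts to substituting `r` in the `q j`. -/
theorem map_substHom_of_toFrac_eq_prodSubst {f g F : (LaurentSeries k)[X]}
    (hg : g ∈ MStarSet k) (hF : toFrac F = prodSubst f (puiseuxRoots g))
    {h : (LaurentSeries k)[X]} (hh : h ∈ MStarSet k) {s : HahnSeries ℚ k}
    (hs : s ∈ puiseuxRoots h) :
    F.map (substHom s) = prodSubst f (g.map (substHom s)).roots := by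
  obtain ⟨-, m, n, q, hq, hq0⟩ := hg
  obtain ⟨r, hr, rfl⟩ := exists_pow_eq_of_mem_puiseuxRoots hh hs n
  have hroots : (g.map (substHom (r ^ (n : ℕ)))).roots =
      Finset.univ.val.map fun i => substHom r (q i) := by
    rw [map_substHom_pow hq hr, roots_prod_univ_X_sub_C]
  have hram : F.map (ramify k n) = ∏ i, f.map (substHom (q i)) := by
    refine Polynomial.map_injective _ (fracSubst k n).injective ?_
    rw [map_fracSubst_map_ramify, hF, puiseuxRoots_eq hq, prodSubst, Multiset.map_map,
      Polynomial.map_prod, Finset.prod_eq_multiset_prod]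
    congr 1
    refine Multiset.map_congr rfl fun i _ => ?_
    rw [Function.comp_apply, Polynomial.map_map, fracSubst_comp_substHom n (hq0 i).isPosOrder]
  rw [hroots, ← substHom_comp_ramify hr, ← Polynomial.map_map, hram, prodSubst, Multiset.map_map,
    Polynomial.map_prod, Finset.prod_eq_multiset_prod]
  congr 1
  refine Multiset.map_congr rfl fun i _ => ?_
  rw [Function.comp_apply, Polynomial.map_map, substHom_comp_substHom hr (hq0 i).isPosOrder]

theorem X_sub_C_mem_MStarSet {c : LaurentSeries k} (hc : IsPosOrder c) :
    X - C c ∈ MStarSet k := by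
  refine mem_MStarSet_iff.2 ⟨X_sub_C_mem_MSet c, fun a ha => ?_⟩
  rw [puiseuxRoots_X_sub_C, Multiset.mem_singleton] at ha
  exact ha ▸ isPosOrder_fracSubst_iff.2 hc

/-- The composed product is a noncommutative monoid structure on `𝕄*`. -/
theorem exists_composedProd_monoid (k : Type*) [Field k] [IsAlgClosed k] [CharZero k] :
    ∃ op : MStarSet k → MStarSet k → MStarSet k,
      (∀ (f g : MStarSet k) (h : (LaurentSeries k)[X]),
        IsComposedProd f.1 g.1 h ↔ h = (op f g).1) ∧
      (∀ f g h, op (op f g) h = op f (op g h)) ∧ (∃ f g, op f g ≠ op g f) ∧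
      ∃ e : MStarSet k, e.1 = X - C (HahnSeries.single (1 : ℤ) (1 : k)) ∧
        ∀ f, op e f = f ∧ op f e = f := by
  choose op hop using exists_toFrac_eq_prodSubst (k := k)
  have hX : IsPosOrder (HahnSeries.single (1 : ℤ) (1 : k)) := isPosOrder_single one_pos one_ne_zero
  have hxH : fracSubst k 1 (HahnSeries.single (1 : ℤ) (1 : k)) = HahnSeries.single 1 1 := by
    simp [fracSubst_single]
  refine ⟨op, fun f g h => isComposedProd_iff f.2 g.2 (hop f g), fun f g h => ?_, ?_,
    ⟨_, X_sub_C_mem_MStarSet hX⟩, rfl, fun f => ⟨?_, ?_⟩⟩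
  · refine Subtype.ext (toFrac_injective ?_)
    rw [hop, hop, puiseuxRoots.eq_1 (op g h).1, hop, roots_prodSubst g.2.1.1, prodSubst, prodSubst,
      Multiset.map_bind, Multiset.prod_bind]
    congr 1
    refine Multiset.map_congr rfl fun s hs => ?_
    exact map_substHom_of_toFrac_eq_prodSubst g.2 (hop f g) h.2 hs
  · -- `y - x²` and `y - 2x` have the composed products `y - 4x²` and `y - 2x²`.
    set x : LaurentSeries k := HahnSeries.single 1 1
    have ha : IsPosOrder (x ^ 2) := hX.pow 2
    have hb : IsPosOrder (HahnSeries.C 2 * x) := by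
      rw [HahnSeries.C_apply, HahnSeries.single_mul_single]
      exact isPosOrder_single (by simp) (by simp)
    have hop' {a b : LaurentSeries k} (ha : IsPosOrder a) (hb : IsPosOrder b) :
        toFrac (op ⟨_, X_sub_C_mem_MStarSet ha⟩ ⟨_, X_sub_C_mem_MStarSet hb⟩).1 =
          X - C (substHom (fracSubst k 1 b) a) := by
      rw [hop, puiseuxRoots_X_sub_C, prodSubst]
      simp
    refine ⟨⟨_, X_sub_C_mem_MStarSet ha⟩, ⟨_, X_sub_C_mem_MStarSet hb⟩, fun h => ?_⟩
    have h1 := congrArg (fun F : MStarSet k => toFrac F.1) h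
    rw [hop' ha hb, hop' hb ha] at h1
    have h2 := C_injective (sub_right_injective h1)
    have hxs {c : LaurentSeries k} (hc : IsPosOrder c) :
        substHom (fracSubst k 1 c) x = fracSubst k 1 c :=
      substHom_X (isPosOrder_fracSubst_iff.2 hc)
    rw [map_pow, hxs hb, map_mul (substHom _), substHom_C (isPosOrder_fracSubst_iff.2 ha), hxs ha,
      ← (isIntegralHom_fracSubst 1).map_C, ← map_mul, ← map_pow] at h2
    have h3 := (fracSubst k 1).injective h2
    rw [mul_pow] at h3
    have h4 := HahnSeries.C_injective
      ((map_pow _ _ _).trans (mul_right_cancel₀ ha.1 h3))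
    norm_num at h4
  · refine Subtype.ext (toFrac_injective ?_)
    rw [hop, ← prod_puiseuxRoots f.2.1.1, prodSubst]
    congr 1
    refine Multiset.map_congr rfl fun s hs => ?_
    rw [Polynomial.map_sub, map_X, map_C, substHom_X ((mem_MStarSet_iff.1 f.2).2 s hs)]
  · refine Subtype.ext (toFrac_injective ?_)
    rw [hop, puiseuxRoots_X_sub_C, prodSubst, hxH, Multiset.map_singleton,
      Multiset.prod_singleton, ← fracSubst_one_eq_substHom, toFrac]

end Product

end BivariateComposed

theorem theorem3p4 (k : Type*) [Field k] [IsAlgClosed k] [CharZero k] :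
    -- (a) the composed sum on `𝕄`
    (∃ op : BivariateComposed.MSet k → BivariateComposed.MSet k → BivariateComposed.MSet k,
      (∀ (f g : BivariateComposed.MSet k) (h : Polynomial (LaurentSeries k)),
        BivariateComposed.IsComposedSum f.1 g.1 h ↔ h = (op f g).1) ∧
      (∀ f g h, op (op f g) h = op f (op g h)) ∧
      (∀ f g, op f g = op g f) ∧
      ∃ e : BivariateComposed.MSet k, e.1 = Polynomial.X ∧ ∀ f, op e f = f ∧ op f e = f) ∧
    -- (b) the composed multiplication on `𝕄`
    (∃ op : BivariateComposed.MSet k → BivariateComposed.MSet k → BivariateComposed.MSet k,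
      (∀ (f g : BivariateComposed.MSet k) (h : Polynomial (LaurentSeries k)),
        BivariateComposed.IsComposedMul f.1 g.1 h ↔ h = (op f g).1) ∧
      (∀ f g h, op (op f g) h = op f (op g h)) ∧
      (∀ f g, op f g = op g f) ∧
      ∃ e : BivariateComposed.MSet k, e.1 = Polynomial.X - 1 ∧
        ∀ f, op e f = f ∧ op f e = f) ∧
    -- (c) the composed product on `𝕄*`
    (∃ op : BivariateComposed.MStarSet k → BivariateComposed.MStarSet k →
        BivariateComposed.MStarSet k,
      (∀ (f g : BivariateComposed.MStarSet k) (h : Polynomial (LaurentSeries k)),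
        BivariateComposed.IsComposedProd f.1 g.1 h ↔ h = (op f g).1) ∧
      (∀ f g h, op (op f g) h = op f (op g h)) ∧
      (∃ f g, op f g ≠ op g f) ∧
      ∃ e : BivariateComposed.MStarSet k,
        e.1 = Polynomial.X - Polynomial.C (HahnSeries.single (1 : ℤ) (1 : k)) ∧
        ∀ f, op e f = f ∧ op f e = f) := by
  refine ⟨?_, ?_, BivariateComposed.exists_composedProd_monoid k⟩
  · exact BivariateComposed.exists_composedBy_commMonoid (β := fun a b => a + b)
      (fun χ a b => map_add _ a b) add_assoc add_comm (c := 0) (by simp)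
      (fun a => by rw [map_zero, zero_add])
  · exact BivariateComposed.exists_composedBy_commMonoid (β := fun a b => a * b)
      (fun χ a b => map_mul _ a b) mul_assoc mul_comm (c := 1) (by simp)
      (fun a => by rw [map_one, one_mul])
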